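/- Let $(\mathcal S,d_{\mathcal S})$ and $(\mathcal A,d_{\mathcal A})$ be compact metric spaces equipped with finite Borel measures $\mu$ and $\nu$ (for example $[0,1]^{d_1}$ and $[0,1]^{d_2}$ with Lebesgue measure), and let $Q^*:\mathcal S\times\mathcal A\to\mathbb R$ be $L$-Lipschitz for the product metric: $|Q^*(s_1,a_1)-Q^*(s_2,a_2)|\le L\,(d_{\mathcal S}(s_1,s_2)+d_{\mathcal A}(a_1,a_2))$ for all $s_1,s_2\in\mathcal S$ and $a_1,a_2\in\mathcal A$. Let $N=\min(\dim L^2(\mathcal S,\mu),\dim L^2(\mathcal A,\nu))\in\{0,1,2,\dots\}\cup\{\infty\}$ (so $N=\infty$ for the cubes when $d_1,d_2\ge1$). Then $Q^*\in L^2(\mathcal S\times\mathcal A,\mu\times\nu)$; the formula $(K\varphi)(a)=\int_{\mathcal S}Q^*(s,a)\varphi(s)\,d\mu(s)$ defines a Hilbert–Schmidt operator $K:L^2(\mathcal S,\mu)\to L^2(\mathcal A,\nu)$; and there are a nonincreasing sequence $\sigma_1\ge\sigma_2\ge\dots\ge0$ with $\sum_{i\ge1}\sigma_i^2<\infty$ and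 $\sigma_i=0$ for $i>N$, and orthonormal families $\{f_i\}_{1\le i\le N}$ in $L^2(\mathcal S,\mu)$ and $\{g_i\}_{1\le i\le N}$ in $L^2(\mathcal A,\nu)$ (indexed by all $i\ge1$ if $N=\infty$), such that $$K\varphi=\sum_{i}\sigma_i\langle f_i,\varphi\rangle g_i\ \text{ in } L^2(\mathcal A,\nu)\text{ for every }\varphi\in L^2(\mathcal S,\mu),\qquad Q^*=\sum_{i}\sigma_i\,f_i\otimes g_i\ \text{ in } L^2(\mathcal S\times\mathcal A,\mu\times\nu),$$ where $(f\otimes g)(s,a)=f(s)g(a)$ and where terms with $i>N$ are read as $0$. Consequently, for every $r\ge0$, $$\int_{\mathcal S\times\mathcal A}\Big(\sum_{i=1}^{r}\sigma_if_i(s)g_i(a)-Q^*(s,a)\Big)^2d(\mu\times\nu)(s,a)=\sum_{i>r}\sigma_i^2,$$ and for every $\delta>0$ there is $r^*(\delta)\in\mathbb N$ such that this quantity is at most $\delta$ for all $r\ge r^*(\delta)$. -/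

import Mathlib

open MeasureTheory

/-- The dimension of the Hilbert space `L²(μ)`, as an extended natural number
(`⊤` when the space is infinite-dimensional). -/
noncomputable def l2Dim {X : Type*} [MeasurableSpace X] (μ : Measure X) : ℕ∞ :=
  Cardinal.toENat (Module.rank ℝ (Lp ℝ 2 μ))

/-- The function `(s, a) ↦ f s * g a` is square integrable on the product when `f` and `g` are. -/
theorem memLp_tensor {S A : Type*} [MeasurableSpace S] [MeasurableSpace A]
    {μ : Measure S} {ν : Measure A} [IsFiniteMeasure μ] [IsFiniteMeasure ν]
    (f : Lp ℝ 2 μ) (g : Lp ℝ 2 ν) :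
    MemLp (fun p : S × A => f p.1 * g p.2) 2 (μ.prod ν) := by
  have hf := Lp.memLp f
  have hg := Lp.memLp g
  have hm : AEStronglyMeasurable (fun p : S × A => f p.1 * g p.2) (μ.prod ν) :=
    hf.aestronglyMeasurable.comp_fst.mul hg.aestronglyMeasurable.comp_snd
  rw [memLp_two_iff_integrable_sq hm]
  simp only [mul_pow]
  exact Integrable.mul_prod hf.integrable_sq hg.integrable_sq

/-- The elementary tensor `f ⊗ g ∈ L²(μ × ν)`, that is, the class of `(s, a) ↦ f s * g a`. -/
noncomputable def tensorL2 {S A : Type*} [MeasurableSpace S] [MeasurableSpace A]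
    {μ : Measure S} {ν : Measure A} [IsFiniteMeasure μ] [IsFiniteMeasure ν]
    (f : Lp ℝ 2 μ) (g : Lp ℝ 2 ν) : Lp ℝ 2 (μ.prod ν) :=
  (memLp_tensor f g).toLp (fun p : S × A => f p.1 * g p.2)

/-- `K : L²(μ) → L²(ν)` is the integral operator with kernel `Q`:
`(K φ)(a) = ∫ Q(s, a) φ(s) dμ(s)` for almost every `a`, the integral being convergent. -/
def IsIntegralOperator {S A : Type*} [MeasurableSpace S] [MeasurableSpace A]
    {μ : Measure S} {ν : Measure A} (Q : S × A → ℝ) (K : Lp ℝ 2 μ →L[ℝ] Lp ℝ 2 ν) : Prop :=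
  ∀ φ : Lp ℝ 2 μ, ∀ᵐ a ∂ν,
    Integrable (fun s => Q (s, a) * φ s) μ ∧ K φ a = ∫ s, Q (s, a) * φ s ∂μ

/-- A bounded operator between Hilbert spaces is Hilbert–Schmidt if `∑ ‖K e‖²` converges, `e`
running over an orthonormal basis (here: over any orthonormal basis). -/
def IsHilbertSchmidt {E F : Type*} [NormedAddCommGroup E] [InnerProductSpace ℝ E]
    [NormedAddCommGroup F] [InnerProductSpace ℝ F] (K : E →L[ℝ] F) : Prop :=
  ∀ (w : Set E) (e : HilbertBasis w ℝ E), Summable fun i : w => ‖K (e i)‖ ^ 2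

/-!
A Lipschitz function `Q` on a compact product is continuous and bounded, so it lies in `L²(μ × ν)`
and defines a bounded operator `K : L²(μ) → L²(ν)` with `⟪K φ, ψ⟫ = ⟪Q, φ ⊗ ψ⟫`
(`exists_isIntegralOperator`, `IsIntegralOperator.hasL2Kernel`). Elementary tensors are total in
`L²(μ × ν)` (`eq_zero_of_forall_inner_tensorL2`); hence `K` is a norm limit of operators of finite
rank, and is compact (`HasL2Kernel.isCompactOperator`).

A compact operator attains its norm at a pair of singular vectors (`exists_singular_vectors`).
Splitting such pairs off one after the other gives the singular values in decreasing order
(`exists_isSingularSystem`). The procedure goes on through the kernel of `K` once the remaining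
operator vanishes, and stops only when one of the two spaces is exhausted, so the orthonormal
families have length exactly `min (dim L²(μ)) (dim L²(ν))`.

The vectors `σ i • f i ⊗ g i` are orthogonal, and each is the projection of `Q` to its own line.
Bessel's inequality therefore gives `∑ σ i ^ 2 < ∞`; so `σ` tends to zero, which makes the Schmidt
expansion of `K` converge (`IsSingularSystem.hasSum_apply`). By totality of the tensors
the sum of the orthogonal series `∑ σ i • f i ⊗ g i` is `Q` (`IsSingularSystem.hasSum_tensorL2`), and
Pythagoras computes the truncation error (`IsSingularSystem.hasSum_sq_tail`).
-/

open scoped InnerProductSpace InnerProduct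

/-! ### Orthogonal sequences and dimension -/

section Orthogonal

variable {E : Type*} [NormedAddCommGroup E] [InnerProductSpace ℝ E]

/-- Finitely many vectors with trivial orthogonal complement span the space, since their span is
closed. -/
theorem rank_le_of_forall_inner_eq_zero (e : ℕ → E) (n : ℕ)
    (h : ∀ z, (∀ j < n, ⟪e j, z⟫_ℝ = 0) → z = 0) : Module.rank ℝ E ≤ n := by
  classical
  let s : Finset E := (Finset.range n).image e
  have hbot : (Submodule.span ℝ (s : Set E))ᗮ = ⊥ := by
    refine (Submodule.eq_bot_iff _).2 fun z hz => h z fun j hj => ?_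
    exact hz _ (Submodule.subset_span (by simpa [s] using ⟨j, hj, rfl⟩))
  have htop : Submodule.span ℝ (s : Set E) = ⊤ := Submodule.orthogonal_eq_bot_iff.1 hbot
  rw [← rank_top, ← htop]
  refine (rank_span_finset_le s).trans ?_
  exact_mod_cast Finset.card_image_le.trans_eq (Finset.card_range n)

theorem natCast_le_rank_of_orthogonal (e : ℕ → E) (n : ℕ) (h1 : ∀ j < n, ‖e j‖ = 1)
    (ho : Pairwise fun i j => ⟪e i, e j⟫_ℝ = 0) : (n : Cardinal) ≤ Module.rank ℝ E := by
  have : Orthonormal ℝ (fun i : Fin n => e i) :=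
    ⟨fun i => h1 i i.2, fun i j hij => ho (fun h => hij (Fin.ext h))⟩
  simpa using this.linearIndependent.cardinal_lift_le_rank

/-- Pythagoras for a convergent orthogonal series; vanishing terms are allowed. -/
theorem HasSum.norm_sq_of_orthogonal {ι : Type*} {v : ι → E} {w : E} (hw : HasSum v w)
    (ho : Pairwise fun i j => ⟪v i, v j⟫_ℝ = 0) : HasSum (fun i => ‖v i‖ ^ 2) (‖w‖ ^ 2) := by
  have h1 : ∀ i, ⟪v i, w⟫_ℝ = ‖v i‖ ^ 2 := fun i => by
    have h := (innerSL ℝ (v i)).hasSum hw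
    have h' := hasSum_single (f := fun j => innerSL ℝ (v i) (v j)) i
      fun j hj => ho hj.symm
    simpa using h.unique h'
  have h2 : HasSum (fun i => ⟪w, v i⟫_ℝ) ⟪w, w⟫_ℝ := (innerSL ℝ w).hasSum hw
  rw [real_inner_self_eq_norm_sq] at h2
  simpa only [fun i => (real_inner_comm (v i) w).trans (h1 i)] using h2

/-- Bessel's inequality in a form that needs no normalization of the orthogonal family `v`: the
hypothesis says that `v i` is the projection of `w` to the line that it spans (or `v i = 0`). -/
theorem summable_norm_sq_of_inner_eq {ι : Type*} {v : ι → E}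
    (ho : Pairwise fun i j => ⟪v i, v j⟫_ℝ = 0) (w : E) (h : ∀ i, ⟪w, v i⟫_ℝ = ‖v i‖ ^ 2) :
    Summable fun i => ‖v i‖ ^ 2 := by
  refine summable_of_sum_le (c := ‖w‖ ^ 2) (fun i => sq_nonneg _) fun u => ?_
  have h1 : ⟪w, ∑ i ∈ u, v i⟫_ℝ = ∑ i ∈ u, ‖v i‖ ^ 2 := by
    rw [inner_sum]
    exact Finset.sum_congr rfl fun i _ => h i
  have h2 : ‖∑ i ∈ u, v i‖ ^ 2 = ∑ i ∈ u, ‖v i‖ ^ 2 := by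
    rw [← real_inner_self_eq_norm_sq, sum_inner]
    refine Finset.sum_congr rfl fun i hi => ?_
    rw [inner_sum, Finset.sum_eq_single_of_mem i hi fun j _ hji => ho hji.symm,
      real_inner_self_eq_norm_sq]
  have h3 := real_inner_le_norm w (∑ i ∈ u, v i)
  rw [h1, ← h2] at h3
  rw [← h2]
  nlinarith [norm_nonneg w, norm_nonneg (∑ i ∈ u, v i)]

end Orthogonal

/-! ### The largest singular value of a compact operator -/

section Hilbert

variable {E F : Type*} [NormedAddCommGroup E] [InnerProductSpace ℝ E] [CompleteSpace E]
  [NormedAddCommGroup F] [InnerProductSpace ℝ F] [CompleteSpace F]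

/-- The adjoint of a compact operator attains its norm: a vector `y` of maximal norm in the compact
closure of the image of the unit ball works, because `‖T‖² = ⟪y, y⟫` is a limit of
`⟪T u, y⟫ = ⟪u, T† y⟫ ≤ ‖T† y‖` with `‖u‖ ≤ 1`. -/
theorem exists_norm_adjoint_apply_eq {T : E →L[ℝ] F} (hT : IsCompactOperator T) (h0 : T ≠ 0) :
    ∃ y : F, ‖y‖ = ‖T‖ ∧ ‖(T†) y‖ = ‖T‖ ^ 2 := by
  have hc : IsCompact (closure (T '' Metric.closedBall 0 1)) :=
    hT.isCompact_closure_image_closedBall (𝕜₁ := ℝ) (𝕜₂ := ℝ) (f := (T : E →ₗ[ℝ] F)) 1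
  have hpos : 0 < ‖T‖ := norm_pos_iff.2 h0
  obtain ⟨y, hy, hmax⟩ := hc.exists_isMaxOn
    (Set.Nonempty.closure ⟨T 0, 0, by simp, rfl⟩) continuous_norm.continuousOn
  have hsub : closure (T '' Metric.closedBall 0 1) ⊆ {y | ‖y‖ ≤ ‖T‖} := by
    refine closure_minimal ?_ (isClosed_le continuous_norm continuous_const)
    rintro _ ⟨u, hu, rfl⟩
    refine (T.le_opNorm u).trans ?_
    exact mul_le_of_le_one_right (norm_nonneg _) (by simpa using hu)
  have hle : ‖y‖ ≤ ‖T‖ := hsub hy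
  have hge : ‖T‖ ≤ ‖y‖ := by
    refine T.opNorm_le_of_unit_norm (norm_nonneg _) fun u hu => ?_
    exact hmax (subset_closure ⟨u, by simp [hu], rfl⟩)
  have hy' : ‖y‖ = ‖T‖ := le_antisymm hle hge
  refine ⟨y, hy', le_antisymm ?_ ?_⟩
  · refine ((T†).le_opNorm y).trans ?_
    rw [hy', LinearIsometryEquiv.norm_map, sq]
  · have : closure (T '' Metric.closedBall 0 1) ⊆ {v | ⟪v, y⟫_ℝ ≤ ‖(T†) y‖} := by
      refine closure_minimal ?_ (isClosed_le (by fun_prop) continuous_const)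
      rintro _ ⟨u, hu, rfl⟩
      change ⟪T u, y⟫_ℝ ≤ _
      rw [← ContinuousLinearMap.adjoint_inner_right]
      exact (real_inner_le_norm _ _).trans
        (mul_le_of_le_one_left (norm_nonneg _) (by simpa using hu))
    have h := this hy
    rwa [Set.mem_ofPred_eq, real_inner_self_eq_norm_sq, hy'] at h

theorem exists_singular_vectors {T : E →L[ℝ] F} (hT : IsCompactOperator T) (h0 : T ≠ 0) :
    ∃ (x : E) (y : F), 0 < ‖T‖ ∧ ‖x‖ = 1 ∧ ‖y‖ = 1 ∧ T x = ‖T‖ • y ∧ (T†) y = ‖T‖ • x := by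
  obtain ⟨y, hy, hTy⟩ := exists_norm_adjoint_apply_eq hT h0
  have hpos : 0 < ‖T‖ := norm_pos_iff.2 h0
  have hx1 : ‖(‖T‖ ^ 2)⁻¹ • (T†) y‖ = 1 := by
    rw [norm_smul, hTy, Real.norm_of_nonneg (by positivity)]; field_simp
  have hy1 : ‖‖T‖⁻¹ • y‖ = 1 := by
    rw [norm_smul, hy, Real.norm_of_nonneg (by positivity)]; field_simp
  have hadj : (T†) (‖T‖⁻¹ • y) = ‖T‖ • (‖T‖ ^ 2)⁻¹ • (T†) y := by
    rw [map_smul, smul_smul]; congr 1; field_simp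
  refine ⟨(‖T‖ ^ 2)⁻¹ • (T†) y, ‖T‖⁻¹ • y, hpos, hx1, hy1, ?_, hadj⟩
  generalize (‖T‖ ^ 2)⁻¹ • (T†) y = x at *
  generalize ‖T‖⁻¹ • y = v at *
  -- equality in Cauchy–Schwarz: `‖T x - ‖T‖ v‖² ≤ ‖T‖² - 2 ‖T‖² + ‖T‖² = 0`
  have h1 : ⟪T x, v⟫_ℝ = ‖T‖ := by
    rw [← ContinuousLinearMap.adjoint_inner_right, hadj, inner_smul_right,
      real_inner_self_eq_norm_sq, hx1]; ring
  have h2 : ‖T x‖ ≤ ‖T‖ := by simpa [hx1] using T.le_opNorm x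
  have h3 : ‖T x - ‖T‖ • v‖ ^ 2 ≤ 0 := by
    rw [norm_sub_sq_real, inner_smul_right, h1, norm_smul, hy1, norm_norm]
    nlinarith [norm_nonneg (T x)]
  have h4 : ‖T x - ‖T‖ • v‖ = 0 := by
    have := norm_nonneg (T x - ‖T‖ • v); nlinarith
  exact sub_eq_zero.1 (norm_eq_zero.1 h4)

/-- A closed subspace `U` of `E` and a subspace `V` of `F` such that `K` maps `U` to `V` and `K†`
maps `V` to `U`. The orthogonal complements of finitely many left and right singular vectors form
such a pair. -/
structure ReducingPair (K : E →L[ℝ] F) where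
  U : Submodule ℝ E
  V : Submodule ℝ F
  isClosed_U : IsClosed (U : Set E)
  map_mem : ∀ x ∈ U, K x ∈ V
  adjoint_mem : ∀ y ∈ V, (K†) y ∈ U

namespace ReducingPair

variable {K : E →L[ℝ] F}

/-- One step of the construction of a singular system: singular vectors in `U` and `V` for the
largest singular value of `K` on `U`. They are unit vectors if `U` and `V` are nonzero, also where
`K` vanishes on `U`. Otherwise `K` vanishes on `U`, and all three objects are zero. -/
theorem exists_top_singular_vectors (hK : IsCompactOperator K) (p : ReducingPair K) :
    ∃ (σ : ℝ) (x : E) (y : F), 0 ≤ σ ∧ x ∈ p.U ∧ y ∈ p.V ∧ K x = σ • y ∧ (K†) y = σ • x ∧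
      (∀ z ∈ p.U, ‖K z‖ ≤ σ * ‖z‖) ∧
      ((p.U ≠ ⊥ ∧ p.V ≠ ⊥ ∧ ‖x‖ = 1 ∧ ‖y‖ = 1) ∨
        ((p.U = ⊥ ∨ p.V = ⊥) ∧ σ = 0 ∧ x = 0 ∧ y = 0)) := by
  have : CompleteSpace p.U := p.isClosed_U.completeSpace_coe
  let T : p.U →L[ℝ] F := K.comp p.U.subtypeL
  have hT : IsCompactOperator T := hK.comp_clm p.U.subtypeL
  have hTz : ∀ z (hz : z ∈ p.U), ‖K z‖ ≤ ‖T‖ * ‖z‖ := fun z hz => T.le_opNorm ⟨z, hz⟩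
  by_cases h0 : T = 0
  · have hK0 : ∀ z ∈ p.U, K z = 0 := fun z hz => by
      change T ⟨z, hz⟩ = 0
      rw [h0]; rfl
    by_cases hb : p.U = ⊥ ∨ p.V = ⊥
    · exact ⟨0, 0, 0, le_rfl, zero_mem _, zero_mem _, by simp, by simp,
        fun z hz => by simp [hK0 z hz], Or.inr ⟨hb, rfl, rfl, rfl⟩⟩
    · push Not at hb
      obtain ⟨x, hx, hx0⟩ := p.U.ne_bot_iff.1 hb.1
      obtain ⟨y, hy, hy0⟩ := p.V.ne_bot_iff.1 hb.2
      have hKy : (K†) y = 0 := by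
        have h := p.adjoint_mem y hy
        rw [← inner_self_eq_zero (𝕜 := ℝ), ContinuousLinearMap.adjoint_inner_left,
          hK0 _ h, inner_zero_right]
      refine ⟨0, ‖x‖⁻¹ • x, ‖y‖⁻¹ • y, le_rfl, p.U.smul_mem _ hx, p.V.smul_mem _ hy, ?_, ?_,
        fun z hz => by simp [hK0 z hz],
        Or.inl ⟨hb.1, hb.2, norm_smul_inv_norm hx0, norm_smul_inv_norm hy0⟩⟩
      · simp [hK0 x hx]
      · simp [hKy]
  · obtain ⟨x, y, hpos, hx, hy, hxy, hyx⟩ := exists_singular_vectors hT h0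
    have hxy' : K x = ‖T‖ • y := hxy
    have hyV : y ∈ p.V := by
      have : y = ‖T‖⁻¹ • K x := by rw [hxy', smul_smul, inv_mul_cancel₀ hpos.ne', one_smul]
      rw [this]
      exact p.V.smul_mem _ (p.map_mem _ x.2)
    have hadj : (K†) y = ‖T‖ • (x : E) := by
      -- both sides lie in `U` and have the same inner products with the elements of `U`
      have hmem := p.adjoint_mem y hyV
      have : (⟨(K†) y, hmem⟩ : p.U) = ‖T‖ • x := by
        refine ext_inner_right ℝ fun z => ?_
        rw [← hyx, ContinuousLinearMap.adjoint_inner_left, Submodule.coe_inner,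
          ContinuousLinearMap.adjoint_inner_left]
        rfl
      exact congrArg Subtype.val this
    refine ⟨‖T‖, x, y, hpos.le, x.2, hyV, hxy', hadj, hTz, Or.inl ⟨?_, ?_, hx, hy⟩⟩
    · exact p.U.ne_bot_iff.2 ⟨x, x.2, fun h => by
        rw [ZeroMemClass.coe_eq_zero.1 h, norm_zero] at hx; exact zero_ne_one hx⟩
    · exact p.V.ne_bot_iff.2 ⟨y, hyV, fun h => by
        rw [h, norm_zero] at hy; exact zero_ne_one hy⟩

variable (K) in
/-- The pair consisting of the whole spaces. -/
def top : ReducingPair K := ⟨⊤, ⊤, isClosed_univ, fun _ _ => trivial, fun _ _ => trivial⟩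

/-- Remove a pair of singular vectors: pass to the vectors of `U` orthogonal to `x` and those of `V`
orthogonal to `y`. -/
noncomputable def split (p : ReducingPair K) (σ : ℝ) (x : E) (y : F) (hx : K x = σ • y)
    (hy : (K†) y = σ • x) : ReducingPair K where
  U := p.U ⊓ (ℝ ∙ x)ᗮ
  V := p.V ⊓ (ℝ ∙ y)ᗮ
  isClosed_U := p.isClosed_U.inter (Submodule.isClosed_orthogonal _)
  map_mem z hz := by
    refine ⟨p.map_mem z hz.1, Submodule.mem_orthogonal_singleton_iff_inner_right.2 ?_⟩
    rw [← ContinuousLinearMap.adjoint_inner_left, hy, inner_smul_left,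
      Submodule.mem_orthogonal_singleton_iff_inner_right.1 hz.2, mul_zero]
  adjoint_mem z hz := by
    refine ⟨p.adjoint_mem z hz.1, Submodule.mem_orthogonal_singleton_iff_inner_right.2 ?_⟩
    rw [ContinuousLinearMap.adjoint_inner_right, hx, inner_smul_left,
      Submodule.mem_orthogonal_singleton_iff_inner_right.1 hz.2, mul_zero]

end ReducingPair

/-- An orthogonal family with square summable norms is summable. Vanishing terms are allowed, as they
occur past the dimension in the singular systems below. -/
theorem summable_of_orthogonal {ι : Type*} {v : ι → E} (ho : Pairwise fun i j => ⟪v i, v j⟫_ℝ = 0)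
    (hs : Summable fun i => ‖v i‖ ^ 2) : Summable v := by
  have hV : OrthogonalFamily ℝ (fun i => (ℝ ∙ v i : Submodule ℝ E))
      fun i => (ℝ ∙ v i : Submodule ℝ E).subtypeₗᵢ := by
    rintro i j hij ⟨x, hx⟩ ⟨y, hy⟩
    obtain ⟨a, rfl⟩ := Submodule.mem_span_singleton.1 hx
    obtain ⟨b, rfl⟩ := Submodule.mem_span_singleton.1 hy
    change ⟪a • v i, b • v j⟫_ℝ = 0
    rw [inner_smul_left, inner_smul_right, ho hij, mul_zero, mul_zero]
  exact (hV.summable_iff_norm_sq_summable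
    fun i => ⟨v i, Submodule.mem_span_singleton_self _⟩).2 hs

end Hilbert

/-! ### Singular systems of compact operators -/

section Schmidt

variable {E F : Type*} [NormedAddCommGroup E] [InnerProductSpace ℝ E] [CompleteSpace E]
  [NormedAddCommGroup F] [InnerProductSpace ℝ F] [CompleteSpace F]

/-- `σ`, `f`, `g` are the singular values and singular vectors of `K`, in decreasing order: unit
vectors for each index below `min (dim E) (dim F)`, and zero from there on. The last field says that
`σ n` is at least the norm of `K` on the orthogonal complement of `f 0, …, f (n - 1)`. -/
structure IsSingularSystem (K : E →L[ℝ] F) (σ : ℕ → ℝ) (f : ℕ → E) (g : ℕ → F) : Prop where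
  antitone : Antitone σ
  nonneg : ∀ i, 0 ≤ σ i
  apply_eq : ∀ i, K (f i) = σ i • g i
  adjoint_apply_eq : ∀ i, (K†) (g i) = σ i • f i
  inner_left : Pairwise fun i j => ⟪f i, f j⟫_ℝ = 0
  inner_right : Pairwise fun i j => ⟪g i, g j⟫_ℝ = 0
  norm_eq : ∀ i : ℕ, (i : ℕ∞) < min (Module.rank ℝ E).toENat (Module.rank ℝ F).toENat →
    ‖f i‖ = 1 ∧ ‖g i‖ = 1
  eq_zero : ∀ i : ℕ, min (Module.rank ℝ E).toENat (Module.rank ℝ F).toENat ≤ (i : ℕ∞) →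
    σ i = 0 ∧ f i = 0 ∧ g i = 0
  norm_apply_le : ∀ n z, (∀ j < n, ⟪f j, z⟫_ℝ = 0) → ‖K z‖ ≤ σ n * ‖z‖

/-- Greedy construction: take out a pair of singular vectors for the largest singular value, and go
on with the orthogonal complements. -/
theorem exists_isSingularSystem {K : E →L[ℝ] F} (hK : IsCompactOperator K) :
    ∃ σ f g, IsSingularSystem K σ f g := by
  choose s x y hs hx hy hKx hKy hmax hdich using
    ReducingPair.exists_top_singular_vectors hK
  let p : ℕ → ReducingPair K :=
    fun n => Nat.rec (ReducingPair.top K) (fun _ q => q.split (s q) (x q) (y q) (hKx q) (hKy q)) n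
  have memU : ∀ n z, z ∈ (p n).U ↔ ∀ j < n, ⟪x (p j), z⟫_ℝ = 0 := by
    intro n z
    induction n with
    | zero => simp [p, ReducingPair.top]
    | succ n ih =>
      rw [Nat.forall_lt_succ_right, ← ih]
      exact and_congr_right fun _ => Submodule.mem_orthogonal_singleton_iff_inner_right
  have memV : ∀ n z, z ∈ (p n).V ↔ ∀ j < n, ⟪y (p j), z⟫_ℝ = 0 := by
    intro n z
    induction n with
    | zero => simp [p, ReducingPair.top]
    | succ n ih =>
      rw [Nat.forall_lt_succ_right, ← ih]
      exact and_congr_right fun _ => Submodule.mem_orthogonal_singleton_iff_inner_right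
  have oU : Pairwise fun i j => ⟪x (p i), x (p j)⟫_ℝ = 0 := by
    intro i j hij
    rcases hij.lt_or_gt with h | h
    · exact (memU j _).1 (hx _) i h
    · rw [real_inner_comm]; exact (memU i _).1 (hx _) j h
  have oV : Pairwise fun i j => ⟪y (p i), y (p j)⟫_ℝ = 0 := by
    intro i j hij
    rcases hij.lt_or_gt with h | h
    · exact (memV j _).1 (hy _) i h
    · rw [real_inner_comm]; exact (memV i _).1 (hy _) j h
  have anti : ∀ m n, m ≤ n → (p n).U ≤ (p m).U ∧ (p n).V ≤ (p m).V := fun m n hmn =>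
    ⟨fun z hz => (memU m z).2 fun j hj => (memU n z).1 hz j (hj.trans_le hmn),
      fun z hz => (memV m z).2 fun j hj => (memV n z).1 hz j (hj.trans_le hmn)⟩
  -- both complements stay nonzero exactly for the first `min (dim E) (dim F)` steps
  have key : ∀ i : ℕ, (i : ℕ∞) < min (Module.rank ℝ E).toENat (Module.rank ℝ F).toENat ↔
      (p i).U ≠ ⊥ ∧ (p i).V ≠ ⊥ := by
    intro i
    constructor
    · intro h
      rw [lt_min_iff, Cardinal.natCast_lt_toENat, Cardinal.natCast_lt_toENat] at h
      refine ⟨fun hb => h.1.not_ge (rank_le_of_forall_inner_eq_zero (fun j => x (p j)) i ?_),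
        fun hb => h.2.not_ge (rank_le_of_forall_inner_eq_zero (fun j => y (p j)) i ?_)⟩
      · exact fun z hz => (Submodule.eq_bot_iff _).1 hb z ((memU i z).2 hz)
      · exact fun z hz => (Submodule.eq_bot_iff _).1 hb z ((memV i z).2 hz)
    · intro h
      have hn : ∀ j < i + 1, ‖x (p j)‖ = 1 ∧ ‖y (p j)‖ = 1 := by
        intro j hj
        have hle := anti j i (Nat.lt_succ_iff.1 hj)
        rcases hdich (p j) with h' | h'
        · exact h'.2.2
        · rcases h'.1 with h' | h'
          · exact absurd (le_bot_iff.1 (h' ▸ hle.1)) h.1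
          · exact absurd (le_bot_iff.1 (h' ▸ hle.2)) h.2
      have h1 := natCast_le_rank_of_orthogonal (fun j => x (p j)) _ (fun j hj => (hn j hj).1) oU
      have h2 := natCast_le_rank_of_orthogonal (fun j => y (p j)) _ (fun j hj => (hn j hj).2) oV
      -- the same inequality in the universes of `E` and of `F`
      have hlt : (i : Cardinal) < ((i + 1 : ℕ) : Cardinal) := by exact_mod_cast i.lt_succ_self
      have hlt' : (i : Cardinal) < ((i + 1 : ℕ) : Cardinal) := by exact_mod_cast i.lt_succ_self
      rw [lt_min_iff, Cardinal.natCast_lt_toENat, Cardinal.natCast_lt_toENat]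
      exact ⟨hlt.trans_le h1, hlt'.trans_le h2⟩
  have heq0 : ∀ i : ℕ, min (Module.rank ℝ E).toENat (Module.rank ℝ F).toENat ≤ (i : ℕ∞) →
      s (p i) = 0 ∧ x (p i) = 0 ∧ y (p i) = 0 := by
    intro i hi
    rcases hdich (p i) with h | h
    · exact absurd ((key i).2 ⟨h.1, h.2.1⟩) hi.not_gt
    · exact h.2
  have hne : ∀ i : ℕ, (i : ℕ∞) < min (Module.rank ℝ E).toENat (Module.rank ℝ F).toENat →
      ‖x (p i)‖ = 1 ∧ ‖y (p i)‖ = 1 := by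
    intro i hi
    have hi := (key i).1 hi
    rcases hdich (p i) with h | h
    · exact h.2.2
    · exact (h.1.elim hi.1 hi.2).elim
  have hle : ∀ n z, (∀ j < n, ⟪x (p j), z⟫_ℝ = 0) → ‖K z‖ ≤ s (p n) * ‖z‖ :=
    fun n z hz => hmax _ z ((memU n z).2 hz)
  refine ⟨fun n => s (p n), fun n => x (p n), fun n => y (p n), ?_, fun _ => hs _, fun _ => hKx _,
    fun _ => hKy _, oU, oV, hne, heq0, hle⟩
  refine antitone_nat_of_succ_le fun n => ?_
  rcases lt_or_ge ((n + 1 : ℕ) : ℕ∞) (min (Module.rank ℝ E).toENat (Module.rank ℝ F).toENat)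
    with h | h
  · have h1 := hmax (p n) (x (p (n + 1))) ((anti n (n + 1) n.le_succ).1 (hx _))
    rwa [hKx, norm_smul, (hne _ h).1, (hne _ h).2, Real.norm_of_nonneg (hs _), mul_one,
      mul_one] at h1
  · rw [(heq0 _ h).1]; exact hs _

namespace IsSingularSystem

variable {K : E →L[ℝ] F} {σ : ℕ → ℝ} {f : ℕ → E} {g : ℕ → F}

theorem norm_eq_or_eq_zero (h : IsSingularSystem K σ f g) (i : ℕ) :
    (‖f i‖ = 1 ∧ ‖g i‖ = 1) ∨ (σ i = 0 ∧ f i = 0 ∧ g i = 0) :=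
  (lt_or_ge _ _).imp (h.norm_eq i) (h.eq_zero i)

/-- The Schmidt expansion. The remainder after `n` terms has norm at most `σ n * ‖φ‖`, by maximality
of `σ n`. -/
theorem hasSum_apply (h : IsSingularSystem K σ f g) (hσ : Summable fun i => σ i ^ 2) (φ : E) :
    HasSum (fun i => (σ i * ⟪f i, φ⟫_ℝ) • g i) (K φ) := by
  have hb : ∀ i, |⟪f i, φ⟫_ℝ| ≤ ‖φ‖ := fun i => by
    rcases h.norm_eq_or_eq_zero i with hi | hi
    · simpa [hi.1] using abs_real_inner_le_norm (f i) φ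
    · simp [hi.2.1]
  have hs : Summable fun i => (σ i * ⟪f i, φ⟫_ℝ) • g i := by
    refine summable_of_orthogonal (fun i j hij => ?_) ?_
    · simp only [inner_smul_left, inner_smul_right, h.inner_right hij, mul_zero]
    · refine Summable.of_nonneg_of_le (fun i => sq_nonneg _) (fun i => ?_) (hσ.mul_right (‖φ‖ ^ 2))
      rcases h.norm_eq_or_eq_zero i with hi | hi
      · rw [norm_smul, hi.2, mul_one, Real.norm_eq_abs, sq_abs, mul_pow]
        exact mul_le_mul_of_nonneg_left (sq_le_sq.2 ((hb i).trans (le_abs_self _))) (sq_nonneg _)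
      · simp [hi.1]
  refine (hs.hasSum_iff_tendsto_nat).2 ?_
  -- the remainder after `n` terms is `K z n` with `z n` orthogonal to `f 0, …, f (n - 1)`
  let z : ℕ → E := fun n => φ - ∑ i ∈ Finset.range n, ⟪f i, φ⟫_ℝ • f i
  have hz : ∀ n, ∀ j < n, ⟪f j, z n⟫_ℝ = 0 := by
    intro n j hj
    simp only [z, inner_sub_right, inner_sum, inner_smul_right]
    rw [Finset.sum_eq_single_of_mem j (Finset.mem_range.2 hj)
      fun i _ hij => by rw [h.inner_left hij.symm, mul_zero]]
    rcases h.norm_eq_or_eq_zero j with hi | hi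
    · rw [real_inner_self_eq_norm_sq, hi.1]; ring
    · simp [hi.2.1]
  have hzn : ∀ n, ‖z n‖ ≤ ‖φ‖ := by
    intro n
    have h0 : ⟪z n, ∑ i ∈ Finset.range n, ⟪f i, φ⟫_ℝ • f i⟫_ℝ = 0 := by
      rw [inner_sum]
      refine Finset.sum_eq_zero fun i hi => ?_
      rw [inner_smul_right, real_inner_comm (f i) (z n), hz n i (Finset.mem_range.1 hi), mul_zero]
    have h1 : ⟪z n, φ⟫_ℝ = ‖z n‖ ^ 2 := by
      rw [← real_inner_self_eq_norm_sq]
      conv_rhs => rw [show z n = φ - ∑ i ∈ Finset.range n, ⟪f i, φ⟫_ℝ • f i from rfl]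
      rw [inner_sub_right, h0, sub_zero]
    have h2 := real_inner_le_norm (z n) φ
    rcases (norm_nonneg (z n)).eq_or_lt with h3 | h3
    · rw [← h3]; exact norm_nonneg _
    · rw [h1, sq] at h2
      exact le_of_mul_le_mul_left h2 h3
  have hKz : ∀ n, K φ - ∑ i ∈ Finset.range n, (σ i * ⟪f i, φ⟫_ℝ) • g i = K (z n) := by
    intro n
    simp only [z, map_sub, map_sum, map_smul, h.apply_eq, smul_smul, mul_comm]
  have hσ0 : Filter.Tendsto σ Filter.atTop (nhds 0) := by
    have := hσ.tendsto_atTop_zero.sqrt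
    simpa [Real.sqrt_sq (h.nonneg _)] using this
  rw [← tendsto_sub_nhds_zero_iff, tendsto_zero_iff_norm_tendsto_zero]
  refine squeeze_zero (fun _ => norm_nonneg _) (fun n => ?_) (by simpa using hσ0.mul_const ‖φ‖)
  rw [norm_sub_rev, hKz]
  exact (h.norm_apply_le n _ (hz n)).trans (mul_le_mul_of_nonneg_left (hzn n) (h.nonneg n))

end IsSingularSystem

end Schmidt

/-! ### Elementary tensors and operators with square integrable kernel -/

section Tensor

variable {S A : Type*} [MeasurableSpace S] [MeasurableSpace A]
  {μ : Measure S} {ν : Measure A} [IsFiniteMeasure μ] [IsFiniteMeasure ν]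

theorem coeFn_tensorL2 (f : Lp ℝ 2 μ) (g : Lp ℝ 2 ν) :
    tensorL2 f g =ᵐ[μ.prod ν] fun p => f p.1 * g p.2 :=
  (memLp_tensor f g).coeFn_toLp

theorem inner_tensorL2_tensorL2 (f f' : Lp ℝ 2 μ) (g g' : Lp ℝ 2 ν) :
    ⟪tensorL2 f g, tensorL2 f' g'⟫_ℝ = ⟪f, f'⟫_ℝ * ⟪g, g'⟫_ℝ := by
  rw [L2.inner_def, L2.inner_def, L2.inner_def, ← integral_prod_mul]
  refine integral_congr_ae ?_
  filter_upwards [coeFn_tensorL2 f g, coeFn_tensorL2 f' g'] with p h h'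
  simp only [h, h', RCLike.inner_apply, conj_trivial]
  ring

theorem norm_tensorL2 (f : Lp ℝ 2 μ) (g : Lp ℝ 2 ν) : ‖tensorL2 f g‖ = ‖f‖ * ‖g‖ := by
  refine (sq_eq_sq₀ (norm_nonneg _) (by positivity)).1 ?_
  rw [← real_inner_self_eq_norm_sq, inner_tensorL2_tensorL2, real_inner_self_eq_norm_sq,
    real_inner_self_eq_norm_sq, mul_pow]

/-- Elementary tensors are total in `L²(μ × ν)`: testing against indicators of rectangles shows that
`P` integrates to zero over every measurable set. -/
theorem eq_zero_of_forall_inner_tensorL2 (P : Lp ℝ 2 (μ.prod ν))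
    (h : ∀ f g, ⟪P, tensorL2 f g⟫_ℝ = 0) : P = 0 := by
  have hP : Integrable P (μ.prod ν) := (Lp.memLp P).integrable one_le_two
  have hrect : ∀ s t, MeasurableSet s → MeasurableSet t → ∫ p in s ×ˢ t, P p ∂(μ.prod ν) = 0 := by
    intro s t hs ht
    rw [← h (indicatorConstLp 2 hs (measure_ne_top μ s) 1)
      (indicatorConstLp 2 ht (measure_ne_top ν t) 1), L2.inner_def,
      ← integral_indicator (hs.prod ht)]
    refine integral_congr_ae ?_
    have h1 := Measure.quasiMeasurePreserving_fst (μ := μ) (ν := ν) |>.ae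
      (indicatorConstLp_coeFn (p := 2) (hs := hs) (hμs := measure_ne_top μ s) (c := (1 : ℝ)))
    have h2 := Measure.quasiMeasurePreserving_snd (μ := μ) (ν := ν) |>.ae
      (indicatorConstLp_coeFn (p := 2) (hs := ht) (hμs := measure_ne_top ν t) (c := (1 : ℝ)))
    filter_upwards [coeFn_tensorL2 (indicatorConstLp 2 hs (measure_ne_top μ s) (1 : ℝ))
      (indicatorConstLp 2 ht (measure_ne_top ν t) (1 : ℝ)), h1, h2] with p hp hp1 hp2
    rw [hp, hp1, hp2]
    by_cases hps : p.1 ∈ s <;> by_cases hpt : p.2 ∈ t <;> simp [hps, hpt]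
  have hall : ∀ u, MeasurableSet u → ∫ p in u, P p ∂(μ.prod ν) = 0 := by
    refine MeasurableSpace.induction_on_inter generateFrom_prod.symm isPiSystem_prod ?_ ?_ ?_ ?_
    · simp
    · rintro _ ⟨s, hs, t, ht, rfl⟩
      exact hrect s t hs ht
    · intro u hu hu0
      have h1 := integral_add_compl hu hP
      have h2 := hrect Set.univ Set.univ .univ .univ
      rw [Set.univ_prod_univ, setIntegral_univ] at h2
      rwa [hu0, h2, zero_add] at h1
    · intro u hd hu hu0
      rw [integral_iUnion hu hd hP.integrableOn]
      simp [hu0]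
  rw [Lp.eq_zero_iff_ae_eq_zero]
  exact hP.ae_eq_zero_of_forall_setIntegral_eq_zero fun u hu _ => hall u hu

theorem dense_span_tensorL2 :
    (Submodule.span ℝ (Set.range fun q : Lp ℝ 2 μ × Lp ℝ 2 ν =>
      tensorL2 q.1 q.2)).topologicalClosure = ⊤ := by
  rw [Submodule.topologicalClosure_eq_top_iff, Submodule.eq_bot_iff]
  intro P hP
  refine eq_zero_of_forall_inner_tensorL2 P fun f g => ?_
  rw [real_inner_comm]
  exact hP _ (Submodule.subset_span ⟨(f, g), rfl⟩)

/-- The operator `K : L²(μ) → L²(ν)` has kernel `R ∈ L²(μ × ν)`, in the weak form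
`⟪K φ, ψ⟫ = ⟪R, φ ⊗ ψ⟫`. -/
def HasL2Kernel (K : Lp ℝ 2 μ →L[ℝ] Lp ℝ 2 ν) (R : Lp ℝ 2 (μ.prod ν)) : Prop :=
  ∀ φ ψ, ⟪K φ, ψ⟫_ℝ = ⟪R, tensorL2 φ ψ⟫_ℝ

namespace HasL2Kernel

variable {K : Lp ℝ 2 μ →L[ℝ] Lp ℝ 2 ν} {R : Lp ℝ 2 (μ.prod ν)}

theorem norm_sub_le {K' : Lp ℝ 2 μ →L[ℝ] Lp ℝ 2 ν} {R' : Lp ℝ 2 (μ.prod ν)}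
    (h : HasL2Kernel K R) (h' : HasL2Kernel K' R') : ‖K - K'‖ ≤ ‖R - R'‖ := by
  refine ContinuousLinearMap.opNorm_le_of_re_inner_le (𝕜 := ℝ) (norm_nonneg _) fun φ ψ hφ hψ => ?_
  rw [RCLike.re_to_real, sub_apply, inner_sub_left, h, h', ← inner_sub_left]
  simpa [norm_tensorL2, hφ, hψ] using real_inner_le_norm (R - R') (tensorL2 φ ψ)

/-- `R` is a limit of linear combinations of elementary tensors, whose operators have finite rank. -/
theorem isCompactOperator (h : HasL2Kernel K R) : IsCompactOperator K := by
  have hspan : ∀ R' ∈ Submodule.span ℝ (Set.range fun q : Lp ℝ 2 μ × Lp ℝ 2 ν =>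
      tensorL2 q.1 q.2), ∃ K' : Lp ℝ 2 μ →L[ℝ] Lp ℝ 2 ν,
        IsCompactOperator K' ∧ HasL2Kernel K' R' := by
    intro R' hR'
    induction hR' using Submodule.span_induction with
    | mem R' hR' =>
      obtain ⟨⟨f, g⟩, rfl⟩ := hR'
      refine ⟨(ContinuousLinearMap.toSpanSingleton ℝ g).comp (innerSL ℝ f), ?_, fun φ ψ => ?_⟩
      · exact (isCompactOperator_of_locallyCompactSpace_rng
          (ContinuousLinearMap.toSpanSingleton ℝ g)).comp_clm _
      · rw [inner_tensorL2_tensorL2]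
        simp [inner_smul_left]
    | zero => exact ⟨0, isCompactOperator_zero, fun φ ψ => by simp⟩
    | add R₁ R₂ _ _ h₁ h₂ =>
      obtain ⟨K₁, hc₁, h₁⟩ := h₁
      obtain ⟨K₂, hc₂, h₂⟩ := h₂
      exact ⟨K₁ + K₂, hc₁.add hc₂, fun φ ψ => by
        rw [add_apply, inner_add_left, inner_add_left, h₁, h₂]⟩
    | smul c R' _ h' =>
      obtain ⟨K', hc', h'⟩ := h'
      exact ⟨c • K', hc'.smul c, fun φ ψ => by
        rw [smul_apply, inner_smul_left, inner_smul_left, h']⟩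
  have hR : R ∈ closure (Submodule.span ℝ (Set.range fun q : Lp ℝ 2 μ × Lp ℝ 2 ν =>
      tensorL2 q.1 q.2) : Set (Lp ℝ 2 (μ.prod ν))) := by
    rw [← Submodule.topologicalClosure_coe, dense_span_tensorL2]; trivial
  have hcl : K ∈ closure {T : Lp ℝ 2 μ →L[ℝ] Lp ℝ 2 ν | IsCompactOperator T} := by
    rw [Metric.mem_closure_iff] at hR ⊢
    intro ε hε
    obtain ⟨R', hR', hd⟩ := hR ε hε
    obtain ⟨K', hc, hK'⟩ := hspan R' hR'
    refine ⟨K', hc, ?_⟩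
    rw [dist_eq_norm] at hd ⊢
    exact (h.norm_sub_le hK').trans_lt hd
  exact isClosed_setOfPred_isCompactOperator.closure_subset hcl

/-- For an orthonormal basis `e`, the vectors `e i ⊗ K (e i)` are orthogonal, and `‖K (e i)‖²` is both
the squared norm of such a vector and its inner product with `R`; so Bessel's inequality applies. -/
theorem isHilbertSchmidt (h : HasL2Kernel K R) : IsHilbertSchmidt K := by
  intro w e
  have hn : ∀ i, ‖tensorL2 (e i) (K (e i))‖ = ‖K (e i)‖ := fun i => by
    rw [norm_tensorL2, e.orthonormal.1, one_mul]
  simpa only [hn] using summable_norm_sq_of_inner_eq (v := fun i => tensorL2 (e i) (K (e i)))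
    (fun i j hij => by simp only [inner_tensorL2_tensorL2, e.orthonormal.2 hij, zero_mul]) R
    fun i => by rw [← h, real_inner_self_eq_norm_sq, hn]

end HasL2Kernel

end Tensor

/-! ### The integral operator of a bounded kernel -/

section IntegralOperator

variable {S A : Type*} [MeasurableSpace S] [MeasurableSpace A]
  {μ : Measure S} {ν : Measure A} [IsFiniteMeasure μ] [IsFiniteMeasure ν]

theorem MeasureTheory.Lp.integrable_mul_of_bounded {q : S → ℝ} (hq : Measurable q) {C : ℝ}
    (hC : ∀ s, |q s| ≤ C) (φ : Lp ℝ 2 μ) : Integrable (fun s => q s * φ s) μ :=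
  ((Lp.memLp φ).integrable one_le_two).bdd_mul (c := C) hq.aestronglyMeasurable
    (Filter.Eventually.of_forall hC)

/-- Cauchy–Schwarz against the constant function `1`. -/
theorem integral_abs_le_mul_norm (φ : Lp ℝ 2 μ) :
    ∫ s, |φ s| ∂μ ≤ ‖indicatorConstLp 2 .univ (measure_ne_top μ Set.univ) (1 : ℝ)‖ * ‖φ‖ := by
  have h := real_inner_le_norm (indicatorConstLp 2 .univ (measure_ne_top μ Set.univ) (1 : ℝ)) |φ|
  rw [L2.inner_indicatorConstLp_one, setIntegral_univ, norm_abs_eq_norm] at h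
  rwa [integral_congr_ae (Lp.coeFn_abs φ)] at h

theorem exists_isIntegralOperator {Q : S × A → ℝ} (hQ : Measurable Q) {C : ℝ}
    (hC : ∀ p, |Q p| ≤ C) : ∃ K : Lp ℝ 2 μ →L[ℝ] Lp ℝ 2 ν, IsIntegralOperator Q K := by
  have hint : ∀ (φ : Lp ℝ 2 μ) (a : A), Integrable (fun s => Q (s, a) * φ s) μ := fun φ a =>
    Lp.integrable_mul_of_bounded (hQ.comp measurable_prodMk_right) (fun s => hC (s, a)) φ
  let B : ℝ := ‖indicatorConstLp 2 .univ (measure_ne_top μ Set.univ) (1 : ℝ)‖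
  have hbound : ∀ (φ : Lp ℝ 2 μ) (a : A), |∫ s, Q (s, a) * φ s ∂μ| ≤ |C| * (B * ‖φ‖) := by
    intro φ a
    calc |∫ s, Q (s, a) * φ s ∂μ| ≤ ∫ s, |Q (s, a) * φ s| ∂μ := abs_integral_le_integral_abs
      _ ≤ ∫ s, |C| * |φ s| ∂μ := by
        refine integral_mono (hint φ a).abs
          (((Lp.memLp φ).integrable one_le_two).abs.const_mul _) fun s => ?_
        simp only [abs_mul]
        exact mul_le_mul_of_nonneg_right ((hC _).trans (le_abs_self C)) (abs_nonneg _)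
      _ = |C| * ∫ s, |φ s| ∂μ := integral_const_mul _ _
      _ ≤ _ := mul_le_mul_of_nonneg_left (integral_abs_le_mul_norm φ) (abs_nonneg _)
  have hmeas : ∀ φ : Lp ℝ 2 μ, StronglyMeasurable fun a => ∫ s, Q (s, a) * φ s ∂μ := fun φ =>
    StronglyMeasurable.integral_prod_left' (f := fun p : S × A => Q p * φ p.1)
      (hQ.mul ((Lp.stronglyMeasurable φ).measurable.comp measurable_fst)).stronglyMeasurable
  have hmem : ∀ φ : Lp ℝ 2 μ, MemLp (fun a => ∫ s, Q (s, a) * φ s ∂μ) 2 ν := fun φ =>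
    MemLp.of_bound (hmeas φ).aestronglyMeasurable _ (Filter.Eventually.of_forall (hbound φ))
  let T : Lp ℝ 2 μ →ₗ[ℝ] Lp ℝ 2 ν :=
    { toFun := fun φ => (hmem φ).toLp _
      map_add' := fun φ ψ => by
        rw [← MemLp.toLp_add]
        refine MemLp.toLp_congr _ _ (Filter.Eventually.of_forall fun a => ?_)
        simp only [Pi.add_apply]
        rw [← integral_add (hint φ a) (hint ψ a)]
        refine integral_congr_ae ?_
        filter_upwards [Lp.coeFn_add φ ψ] with s hs
        rw [hs, Pi.add_apply, mul_add]
      map_smul' := fun c φ => by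
        rw [RingHom.id_apply, ← MemLp.toLp_const_smul]
        refine MemLp.toLp_congr _ _ (Filter.Eventually.of_forall fun a => ?_)
        simp only [Pi.smul_apply, smul_eq_mul]
        rw [← integral_const_mul]
        refine integral_congr_ae ?_
        filter_upwards [Lp.coeFn_smul c φ] with s hs
        rw [hs, Pi.smul_apply, smul_eq_mul, mul_left_comm] }
  refine ⟨T.mkContinuous
    ((measureUnivNNReal ν : ℝ) ^ (2 : ENNReal).toReal⁻¹ * (|C| * B)) fun φ => ?_, fun φ => ?_⟩
  · rw [mul_assoc, mul_assoc]
    refine Lp.norm_le_of_ae_bound (by positivity) ?_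
    filter_upwards [(hmem φ).coeFn_toLp] with a ha
    rw [show T φ = (hmem φ).toLp _ from rfl, ha]
    exact hbound φ a
  · filter_upwards [(hmem φ).coeFn_toLp] with a ha
    exact ⟨hint φ a, ha⟩

/-- Fubini's theorem identifies the pointwise and the weak description of the operator. -/
theorem IsIntegralOperator.hasL2Kernel {Q : S × A → ℝ} (hQ : MemLp Q 2 (μ.prod ν))
    {K : Lp ℝ 2 μ →L[ℝ] Lp ℝ 2 ν} (hK : IsIntegralOperator Q K) :
    HasL2Kernel K (hQ.toLp Q) := by
  intro φ ψ
  have h1 : (fun p : S × A => ⟪hQ.toLp Q p, tensorL2 φ ψ p⟫_ℝ) =ᵐ[μ.prod ν]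
      fun p => Q p * (φ p.1 * ψ p.2) := by
    filter_upwards [hQ.coeFn_toLp, coeFn_tensorL2 φ ψ] with p hp hp'
    simp only [hp, hp', RCLike.inner_apply, conj_trivial, mul_comm]
  have h2 : Integrable (fun p => Q p * (φ p.1 * ψ p.2)) (μ.prod ν) :=
    (L2.integrable_inner (𝕜 := ℝ) _ _).congr h1
  rw [L2.inner_def, L2.inner_def, integral_congr_ae h1, integral_prod_symm _ h2]
  refine integral_congr_ae ?_
  filter_upwards [hK φ] with a ha
  rw [ha.2, RCLike.inner_apply, conj_trivial, mul_comm, ← integral_mul_const]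
  simp only [mul_assoc]

end IntegralOperator

/-! ### Expansion of the kernel -/

section Expansion

variable {S A : Type*} [MeasurableSpace S] [MeasurableSpace A]
  {μ : Measure S} {ν : Measure A} [IsFiniteMeasure μ] [IsFiniteMeasure ν]
  {K : Lp ℝ 2 μ →L[ℝ] Lp ℝ 2 ν} {R : Lp ℝ 2 (μ.prod ν)}
  {σ : ℕ → ℝ} {f : ℕ → Lp ℝ 2 μ} {g : ℕ → Lp ℝ 2 ν}

namespace IsSingularSystem

theorem norm_smul_tensorL2_sq (h : IsSingularSystem K σ f g) (i : ℕ) :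
    ‖σ i • tensorL2 (f i) (g i)‖ ^ 2 = σ i ^ 2 := by
  rcases h.norm_eq_or_eq_zero i with hi | hi
  · rw [norm_smul, norm_tensorL2, hi.1, hi.2, mul_one, mul_one, Real.norm_eq_abs, sq_abs]
  · simp [hi.1]

theorem inner_smul_tensorL2 (h : IsSingularSystem K σ f g) :
    Pairwise fun i j => ⟪σ i • tensorL2 (f i) (g i), σ j • tensorL2 (f j) (g j)⟫_ℝ = 0 :=
  fun i j hij => by
    simp only [inner_smul_left, inner_smul_right, inner_tensorL2_tensorL2, h.inner_left hij,
      zero_mul, mul_zero]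

/-- `σ i ^ 2` is the squared norm of `σ i • f i ⊗ g i` and its inner product with `R`. -/
theorem summable_sq (h : IsSingularSystem K σ f g) (hR : HasL2Kernel K R) :
    Summable fun i => σ i ^ 2 := by
  have := summable_norm_sq_of_inner_eq h.inner_smul_tensorL2 R fun i => by
    rw [h.norm_smul_tensorL2_sq, inner_smul_right, ← hR, h.apply_eq, inner_smul_left,
      real_inner_self_eq_norm_sq]
    rcases h.norm_eq_or_eq_zero i with hi | hi
    · simp [hi.2, sq]
    · simp [hi.1]
  simpa only [h.norm_smul_tensorL2_sq] using this

/-- The series converges by orthogonality; its sum has the same inner products with elementary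
tensors as `R`, by the Schmidt expansion of `K`. -/
theorem hasSum_tensorL2 (h : IsSingularSystem K σ f g) (hR : HasL2Kernel K R) :
    HasSum (fun i => σ i • tensorL2 (f i) (g i)) R := by
  have hs : Summable fun i => σ i • tensorL2 (f i) (g i) :=
    summable_of_orthogonal h.inner_smul_tensorL2 <| by
      simpa only [h.norm_smul_tensorL2_sq] using h.summable_sq hR
  obtain ⟨P, hP⟩ := hs
  suffices P - R = 0 by rwa [← sub_eq_zero.1 this]
  refine eq_zero_of_forall_inner_tensorL2 _ fun φ ψ => ?_
  rw [inner_sub_left, sub_eq_zero, ← hR, real_inner_comm, real_inner_comm ψ]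
  have h1 := (innerSL ℝ (tensorL2 φ ψ)).hasSum hP
  have h2 := (innerSL ℝ ψ).hasSum (h.hasSum_apply (h.summable_sq hR) φ)
  refine h1.unique ?_
  convert! h2 using 2 with i
  simp only [innerSL_apply_apply, inner_smul_right, inner_tensorL2_tensorL2]
  rw [real_inner_comm φ, mul_assoc]

theorem hasSum_sq_tail (h : IsSingularSystem K σ f g) (hR : HasL2Kernel K R) (r : ℕ) :
    HasSum (fun i => σ (r + i) ^ 2)
      (‖∑ i ∈ Finset.range r, σ i • tensorL2 (f i) (g i) - R‖ ^ 2) := by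
  have h1 := (hasSum_nat_add_iff' r).2 (h.hasSum_tensorL2 hR)
  have h2 := h1.norm_sq_of_orthogonal
    fun i j hij => h.inner_smul_tensorL2 (fun e => hij (Nat.add_right_cancel e))
  simpa only [h.norm_smul_tensorL2_sq, norm_sub_rev, add_comm] using h2

end IsSingularSystem

theorem integral_sum_sub_sq {Q : S × A → ℝ} (hQ : MemLp Q 2 (μ.prod ν)) (r : ℕ) :
    ∫ p, (∑ i ∈ Finset.range r, σ i * (f i p.1 * g i p.2) - Q p) ^ 2 ∂(μ.prod ν) =
      ‖∑ i ∈ Finset.range r, σ i • tensorL2 (f i) (g i) - hQ.toLp Q‖ ^ 2 := by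
  rw [← real_inner_self_eq_norm_sq, L2.inner_def]
  refine integral_congr_ae ?_
  have h1 : ∀ᵐ p ∂μ.prod ν, ∀ i, (σ i • tensorL2 (f i) (g i) : Lp ℝ 2 (μ.prod ν)) p =
      σ i * (f i p.1 * g i p.2) := by
    refine ae_all_iff.2 fun i => ?_
    filter_upwards [Lp.coeFn_smul (σ i) (tensorL2 (f i) (g i)), coeFn_tensorL2 (f i) (g i)]
      with p hp hp'
    rw [hp, Pi.smul_apply, hp', smul_eq_mul]
  filter_upwards [Lp.coeFn_sub (∑ i ∈ Finset.range r, σ i • tensorL2 (f i) (g i)) (hQ.toLp Q),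
    hQ.coeFn_toLp, h1,
    Lp.coeFn_finsetSum (Finset.range r) fun i => σ i • tensorL2 (f i) (g i)] with p h2 h3 h4 h5
  rw [h2, Pi.sub_apply, h3, h5, Finset.sum_apply]
  simp only [h4, RCLike.inner_apply, conj_trivial, sq]

end Expansion

/-! ### Lipschitz kernels on compact spaces -/

theorem continuous_of_abs_sub_le {S A : Type*} [PseudoMetricSpace S] [PseudoMetricSpace A]
    {Q : S × A → ℝ} {L : ℝ}
    (hL : ∀ s₁ s₂ a₁ a₂, |Q (s₁, a₁) - Q (s₂, a₂)| ≤ L * (dist s₁ s₂ + dist a₁ a₂)) :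
    Continuous Q := by
  refine continuous_iff_continuousAt.2 fun p => ?_
  refine tendsto_iff_dist_tendsto_zero.2 (squeeze_zero (fun _ => dist_nonneg)
    (fun q => hL q.1 p.1 q.2 p.2) ?_)
  have : Continuous fun q : S × A => L * (dist q.1 p.1 + dist q.2 p.2) := by fun_prop
  simpa using this.tendsto p

theorem theorem1 {S A : Type*}
    [MetricSpace S] [CompactSpace S] [MeasurableSpace S] [BorelSpace S]
    [MetricSpace A] [CompactSpace A] [MeasurableSpace A] [BorelSpace A]
    (μ : Measure S) [IsFiniteMeasure μ] (ν : Measure A) [IsFiniteMeasure ν]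
    (Q : S × A → ℝ) (L : ℝ)
    (hL : ∀ s₁ s₂ a₁ a₂, |Q (s₁, a₁) - Q (s₂, a₂)| ≤ L * (dist s₁ s₂ + dist a₁ a₂)) :
    ∃ (hQ : MemLp Q 2 (μ.prod ν)) (K : Lp ℝ 2 μ →L[ℝ] Lp ℝ 2 ν),
      IsIntegralOperator Q K ∧ IsHilbertSchmidt K ∧
      ∃ (σ : ℕ → ℝ) (f : ℕ → Lp ℝ 2 μ) (g : ℕ → Lp ℝ 2 ν),
        Antitone σ ∧ (∀ i, 0 ≤ σ i) ∧ (Summable fun i => σ i ^ 2) ∧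
        (∀ i : ℕ, min (l2Dim μ) (l2Dim ν) ≤ (i : ℕ∞) → σ i = 0) ∧
        Orthonormal ℝ (fun i : {i : ℕ // (i : ℕ∞) < min (l2Dim μ) (l2Dim ν)} => f i) ∧
        Orthonormal ℝ (fun i : {i : ℕ // (i : ℕ∞) < min (l2Dim μ) (l2Dim ν)} => g i) ∧
        (∀ φ : Lp ℝ 2 μ, HasSum (fun i => (σ i * inner ℝ (f i) φ) • g i) (K φ)) ∧
        HasSum (fun i => σ i • tensorL2 (f i) (g i)) (hQ.toLp Q) ∧
        (∀ r : ℕ, HasSum (fun i => σ (r + i) ^ 2)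
          (∫ p, (∑ i ∈ Finset.range r, σ i * (f i p.1 * g i p.2) - Q p) ^ 2 ∂(μ.prod ν))) ∧
        (∀ δ : ℝ, 0 < δ → ∃ r₀ : ℕ, ∀ r, r₀ ≤ r →
          ∫ p, (∑ i ∈ Finset.range r, σ i * (f i p.1 * g i p.2) - Q p) ^ 2 ∂(μ.prod ν) ≤ δ) := by
  have hQc : Continuous Q := continuous_of_abs_sub_le hL
  obtain ⟨C, hC⟩ := isCompact_univ.exists_bound_of_continuousOn hQc.continuousOn
  replace hC : ∀ p, |Q p| ≤ C := fun p => hC p trivial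
  have hQ : MemLp Q 2 (μ.prod ν) :=
    MemLp.of_bound hQc.aestronglyMeasurable C (Filter.Eventually.of_forall hC)
  obtain ⟨K, hK⟩ := exists_isIntegralOperator (μ := μ) (ν := ν) hQc.measurable hC
  have hker := hK.hasL2Kernel hQ
  obtain ⟨σ, f, g, h⟩ := exists_isSingularSystem hker.isCompactOperator
  have htail : ∀ r : ℕ, HasSum (fun i => σ (r + i) ^ 2)
      (∫ p, (∑ i ∈ Finset.range r, σ i * (f i p.1 * g i p.2) - Q p) ^ 2 ∂(μ.prod ν)) :=
    fun r => by rw [integral_sum_sub_sq hQ]; exact h.hasSum_sq_tail hker r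
  refine ⟨hQ, K, hK, hker.isHilbertSchmidt, σ, f, g, h.antitone, h.nonneg, h.summable_sq hker,
    fun i hi => (h.eq_zero i hi).1,
    ⟨fun i => (h.norm_eq i i.2).1, fun i j hij => h.inner_left (Subtype.coe_injective.ne hij)⟩,
    ⟨fun i => (h.norm_eq i i.2).2, fun i j hij => h.inner_right (Subtype.coe_injective.ne hij)⟩,
    h.hasSum_apply (h.summable_sq hker), h.hasSum_tensorL2 hker, htail, fun δ hδ => ?_⟩
  have hlim := tendsto_sum_nat_add fun i => σ i ^ 2
  obtain ⟨r₀, hr₀⟩ := Filter.eventually_atTop.1 (hlim.eventually (gt_mem_nhds hδ))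
  refine ⟨r₀, fun r hr => ?_⟩
  rw [← (htail r).tsum_eq]
  simpa only [add_comm] using (hr₀ r hr).le
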